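/- Let $T>0$, let $W=(W_s)_{s\in[0,T]}$ be a standard one-dimensional Brownian motion on a probability space $(\Omega,\mathcal F,\mathbb P)$, and fix $t\in(0,T]$. For measurable $f:\mathbb R\to\mathbb R$ set $$\overline{\alpha_f}:=\inf\Big\{\alpha>0:\ \limsup_{|x|\to\infty}\tfrac{|f(x)|}{|x|^{\alpha}}<\infty\Big\},\qquad \underline{\alpha_f}:=\inf\Big\{\alpha>0:\ \liminf_{|x|\to\infty}\tfrac{|f(x)|}{|x|^{\alpha}}<\infty\Big\}\in[0,\infty],$$ with $\inf\emptyset=\infty$. Let $v:[0,T]\times\mathbb R\to\mathbb R$ be of class $\mathcal C^{1,1}$ (once differentiable in time and once in space, with $v$ and both partial derivatives jointly continuous), let $v'$ denote the space derivative, and let $P_t:=v(t,W_t)$. Assume that $P_t\in L^1(\mathbb P)$, that $x\mapsto v(t,x)$ is unbounded from above and from below, that $v'(t,x)>0$ for all $x$, that $\underline{\alpha_v}\in(0,\infty)$ and $\overline{\alpha_{v'}}<\infty$ (growth rates of $v(t,\cdot)$ and $v'(t,\cdot)$), and that there are $\tilde\alpha>0$ and $K>0$ with $$\frac1{v'(t,x)}\le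 K(1+|x|^{\tilde\alpha})\qquad\text{for all }x\in\mathbb R .$$ Then $v(t,\cdot)$ is a bijection of $\mathbb R$; let $v^{(-1)}$ be its inverse. Moreover $\overline{\alpha_{v^{(-1)}}}<\infty$, and for all $\varepsilon,\varepsilon'>0$, with $$p:=\overline{\alpha_{v'}}+\varepsilon,\qquad r:=\overline{\alpha_{v^{(-1)}}}+\varepsilon',$$ the constants $$C_{v'}:=\sup_{x\in\mathbb R}\frac{|v'(t,x)|}{1+|x|^{p}},\qquad C_{v^{(-1)}}:=\sup_{y\in\mathbb R}\frac{|v^{(-1)}(y)|}{1+|y|^{r}}$$ are finite. Put $\phi_t(z):=\frac1{\sqrt{2\pi t}}e^{-z^2/(2t)}$, $\delta_s:=\max(1,2^s)$, $\mu_t(\tilde\alpha):=\int_{\mathbb R}\frac{\phi_t(z)}{1+|z|^{\tilde\alpha}}\,dz$, $\Xi_{p}:=\frac{(2t)^{p/2}\,\Gamma(\frac{1+p}2)}{\sqrt\pi}$ $\big(=\int_{\mathbb R}|z|^p\phi_t(z)\,dz\big)$, $$D_p:=\max\Big(1+\delta_p\Xi_p+\tfrac12\big(1+\delta_p(\Xi_p+\tfrac1{1+p})\big)^2,\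 \tfrac12+\tfrac{\delta_p}{1+p}\Big),$$ $$M'(\varepsilon,\varepsilon'):=C_{v'}^2\,D_p\,\big(1+C_{v^{(-1)}}^{2p}\big)\,\delta_{2p},\qquad M(\varepsilon'):=\frac{\mu_t(\tilde\alpha)}{2\,\delta_{\tilde\alpha}\,K^2\big(1+C_{v^{(-1)}}^{2\tilde\alpha}\,\delta_{2\tilde\alpha}\big)} .$$ The law of $P_t$ has a continuous density $\rho_t$ with respect to the Lebesgue measure (independent of $\varepsilon,\varepsilon'$), and for all $\varepsilon,\varepsilon'>0$ and every $y\in\mathbb R$, writing $m:=\mathbb E[P_t]$, $$\rho_t(y)\le\frac{\mathbb E[|P_t-m|]}{2M(\varepsilon')t}\,\big(1+|y|^{2\tilde\alpha r}\big)\exp\Big(-\int_0^{y-m}\frac{(M'(\varepsilon,\varepsilon')t)^{-1}x\,dx}{1+|x+m|^{2pr}}\Big)$$ and $$\rho_t(y)\ge\frac{(2M'(\varepsilon,\varepsilon')t)^{-1}\,\mathbb E[|P_t-m|]}{1+|y|^{2pr}}\exp\Big(-\int_0^{y-m}\frac{x\,\big(1+|x+m|^{2\tilde\alpha r}\big)\,dx}{M(\varepsilon')t}\Big).$$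 -/

import Mathlib

open MeasureTheory ProbabilityTheory Filter Set Topology
open scoped NNReal ENNReal

/-- `W` is a standard one-dimensional Brownian motion on the time interval `[0, T]`: its
finite-dimensional laws at times in `[0, T]` are those of Brownian motion (Mathlib's
`BrownianReal.projectiveFamily`), and almost every path is continuous on `[0, T]`.
Nothing is required of `W` after the time `T`. -/
structure IsBrownianOn {Ω : Type*} [MeasurableSpace Ω] (T : ℝ≥0) (W : ℝ≥0 → Ω → ℝ)
    (P : Measure Ω) : Prop where
  hasLaw : ∀ I : Finset ℝ≥0, (∀ s ∈ I, s ≤ T) →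
    HasLaw (fun ω ↦ I.restrict (W · ω)) (BrownianReal.projectiveFamily I) P
  continuous_paths : ∀ᵐ ω ∂P, ContinuousOn (W · ω) (Icc 0 T)

/-- `v` is of class `C^{1,1}` on `[0, T] × ℝ`: once differentiable in time and once in space,
with `v` and both first partial derivatives jointly continuous
(the time derivative is one-sided at `0` and at `T`). Values of `v` at times outside `[0, T]`
are irrelevant. -/
structure IsC11 (T : ℝ) (v : ℝ → ℝ → ℝ) : Prop where
  continuousOn : ContinuousOn (fun p : ℝ × ℝ ↦ v p.1 p.2) (Icc 0 T ×ˢ univ)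
  differentiable_time : ∀ s ∈ Icc (0 : ℝ) T, ∀ x : ℝ,
    DifferentiableWithinAt ℝ (fun r ↦ v r x) (Icc 0 T) s
  differentiable_space : ∀ s ∈ Icc (0 : ℝ) T, Differentiable ℝ (v s)
  continuousOn_time_deriv :
    ContinuousOn (fun p : ℝ × ℝ ↦ derivWithin (fun r ↦ v r p.2) (Icc 0 T) p.1) (Icc 0 T ×ˢ univ)
  continuousOn_space_deriv :
    ContinuousOn (fun p : ℝ × ℝ ↦ deriv (v p.1) p.2) (Icc 0 T ×ˢ univ)

/-- The growth rate `inf {α > 0 : limsup_{|x| → ∞} |f x| / |x|^α < ∞}`, as an element of `[0, ∞]`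
(`∞` if there is no such `α`). -/
noncomputable def upperGrowthRate (f : ℝ → ℝ) : ℝ≥0∞ :=
  sInf {a : ℝ≥0∞ | ∃ α : ℝ, 0 < α ∧ a = ENNReal.ofReal α ∧
    limsup (fun x : ℝ ↦ ENNReal.ofReal (|f x| / |x| ^ α)) (atBot ⊔ atTop) < ⊤}

/-- The growth rate `inf {α > 0 : liminf_{|x| → ∞} |f x| / |x|^α < ∞}`, as an element of `[0, ∞]`
(`∞` if there is no such `α`). -/
noncomputable def lowerGrowthRate (f : ℝ → ℝ) : ℝ≥0∞ :=
  sInf {a : ℝ≥0∞ | ∃ α : ℝ, 0 < α ∧ a = ENNReal.ofReal α ∧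
    liminf (fun x : ℝ ↦ ENNReal.ofReal (|f x| / |x| ^ α)) (atBot ⊔ atTop) < ⊤}

/-- The quotient `|f x| / (1 + |x|^p)`. -/
noncomputable def growthQuotient (f : ℝ → ℝ) (p x : ℝ) : ℝ := |f x| / (1 + |x| ^ p)

/-- The constant `C_f(p) = sup_x |f x| / (1 + |x|^p)`. -/
noncomputable def growthConst (f : ℝ → ℝ) (p : ℝ) : ℝ := ⨆ x : ℝ, growthQuotient f p x

/-- The constant `δ_p = max (1, 2^p)`. -/
noncomputable def deltaConst (p : ℝ) : ℝ := max 1 (2 ^ p)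

/-- The density of the centered normal law with variance `t`. -/
noncomputable def gaussDensity (t z : ℝ) : ℝ :=
  1 / Real.sqrt (2 * Real.pi * t) * Real.exp (-z ^ 2 / (2 * t))

/-- The constant `Ξ_p(t) = (2t)^{p/2} Γ((1+p)/2) / √π`, which is the `p`-th absolute moment of the
centered normal law with variance `t`. -/
noncomputable def xiConst (t p : ℝ) : ℝ :=
  (2 * t) ^ (p / 2) * Real.Gamma ((1 + p) / 2) / Real.sqrt Real.pi

/-- The constant `μ_t(q) = ∫ φ_t(z) / (1 + |z|^q) dz`. -/
noncomputable def muConst (t q : ℝ) : ℝ := ∫ z : ℝ, gaussDensity t z / (1 + |z| ^ q)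

/-- The constant `D_p(t)`. -/
noncomputable def bigDConst (t p : ℝ) : ℝ :=
  max (1 + deltaConst p * xiConst t p
        + (1 + deltaConst p * (xiConst t p + (1 + p)⁻¹)) ^ 2 / 2)
    (1 / 2 + deltaConst p / (1 + p))

/-- The constant `M'` attached to the functions `f` (the space derivative) and `g` (the inverse)
and the exponents `p` (for `f`) and `r` (for `g`):
`M' = C_f(p)² D_p(t) (1 + C_g(r)^{2p}) δ_{2p}`. -/
noncomputable def upperKernelConst (t : ℝ) (f g : ℝ → ℝ) (p r : ℝ) : ℝ :=
  growthConst f p ^ 2 * bigDConst t p * (1 + growthConst g r ^ (2 * p)) * deltaConst (2 * p)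

/-- The constant `M` attached to the function `g` (the inverse), its exponent `r`, and the
constants `K`, `q` of the lower bound on the space derivative:
`M = μ_t(q) / (2 δ_q K² (1 + C_g(r)^{2q} δ_{2q}))`. -/
noncomputable def lowerKernelConst (t : ℝ) (g : ℝ → ℝ) (r K q : ℝ) : ℝ :=
  muConst t q / (2 * deltaConst q * K ^ 2 * (1 + growthConst g r ^ (2 * q) * deltaConst (2 * q)))

/-!
Write `f = v t`, `g` for its inverse, `φ` for the density of `N(0, t)` and `m` for the mean of
`f (W_t)`. As `W_t` has law `N(0, t)`, the image `f (W_t)` has the continuous density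
`ρ y = φ (g y) / f' (g y)`, and its Stein kernel `h` is defined by
`h y * ρ y = ∫_y^∞ (x - m) ρ x dx`. Differentiating this relation gives
`(log (h ρ))' y = -(y - m) / h y`, and `h m * ρ m` is half the mean absolute deviation `A`, which
yields the Nourdin–Viens formula `imageDensity_eq_exp_steinKernel`:
`ρ y = A / (2 h y) * exp (-∫_0^{y - m} u / h (u + m) du)`.
The integral of `u w u` from `0` to `c` is monotone in the weight `w` for either sign of `c`, so
two-sided bounds on `h` give two-sided bounds on `ρ`.

The bounds on `h` come from Mehler's formula (`setIntegral_Ioi_sub_mean_eq_mehlerAverage`):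
`h (f x) = t f' x ∫_0^{π/2} cos θ 𝔼[f' (sin θ x + cos θ Z)] dθ` with `Z` of law `N(0, t)`.
It is proved by interpolating between two independent Gaussian variables along a rotation, under
which their joint law is invariant; this needs only one continuous derivative of `f`.
Polynomial upper and lower bounds on `f'` turn into polynomial bounds on the average
(`mehlerAverage_le`, `le_mehlerAverage`), hence on `h (f x)` in terms of `x`, and the growth of `g`
turns them into bounds in terms of the value `y = f x` (`imageSteinKernel_le`,
`le_imageSteinKernel`).

The growth of `g` is controlled by the lower growth rate of `f`: if `|f x| ≥ |x|^α` for large `|x|`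
then `|g y| ≤ |y|^{1/α}` for large `|y|` (`upperGrowthRate_lt_top_of_rightInverse`).
-/

/-! ### The centered Gaussian density -/

lemma gaussDensity_eq_gaussianPDFReal (t : ℝ≥0) : gaussDensity t = gaussianPDFReal 0 t := by
  ext z
  simp [gaussDensity, gaussianPDFReal]

lemma gaussDensity_pos {t : ℝ≥0} (ht : 0 < t) (z : ℝ) : 0 < gaussDensity t z := by
  rw [gaussDensity_eq_gaussianPDFReal]
  exact gaussianPDFReal_pos 0 t z ht.ne'

lemma continuous_gaussDensity (t : ℝ) : Continuous (gaussDensity t) := by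
  unfold gaussDensity
  fun_prop

lemma integrable_gaussianReal_iff {t : ℝ≥0} (ht : 0 < t) (f : ℝ → ℝ) :
    Integrable f (gaussianReal 0 t) ↔ Integrable (fun z ↦ gaussDensity t z * f z) := by
  rw [gaussianReal_of_var_ne_zero _ ht.ne',
    integrable_withDensity_iff_integrable_smul' (measurable_gaussianPDF 0 t)
      (ae_of_all _ fun _ ↦ gaussianPDF_lt_top)]
  simp [gaussDensity_eq_gaussianPDFReal, toReal_gaussianPDF]

lemma integral_gaussianReal_eq {t : ℝ≥0} (ht : 0 < t) (f : ℝ → ℝ) :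
    ∫ z, f z ∂(gaussianReal 0 t) = ∫ z, gaussDensity t z * f z := by
  rw [integral_gaussianReal_eq_integral_smul ht.ne']
  simp [gaussDensity_eq_gaussianPDFReal]

lemma setIntegral_gaussianReal_eq {t : ℝ≥0} (ht : 0 < t) (f : ℝ → ℝ) {s : Set ℝ}
    (hs : MeasurableSet s) :
    ∫ z in s, f z ∂(gaussianReal 0 t) = ∫ z in s, gaussDensity t z * f z := by
  rw [← integral_indicator hs, integral_gaussianReal_eq ht, ← integral_indicator hs]
  congr 1
  ext z
  by_cases hz : z ∈ s <;> simp [hz]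

lemma hasDerivAt_gaussDensity {t : ℝ} (ht : 0 < t) (z : ℝ) :
    HasDerivAt (fun z ↦ -(t * gaussDensity t z)) (gaussDensity t z * z) z := by
  unfold gaussDensity
  have h1 : HasDerivAt (fun z : ℝ ↦ -z ^ 2 / (2 * t)) (-(2 * z) / (2 * t)) z := by
    simpa using ((hasDerivAt_pow 2 z).neg).div_const (2 * t)
  convert! ((h1.exp.const_mul (1 / √(2 * Real.pi * t))).const_mul t).neg using 1
  field_simp

lemma tendsto_gaussDensity_atTop {t : ℝ} (ht : 0 < t) :
    Tendsto (gaussDensity t) atTop (𝓝 0) := by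
  have h1 : Tendsto (fun z : ℝ ↦ -z ^ 2 / (2 * t)) atTop atBot := by
    have : Tendsto (fun z : ℝ ↦ z ^ 2 / (2 * t)) atTop atTop :=
      (tendsto_pow_atTop two_ne_zero).atTop_div_const (by positivity)
    refine (tendsto_neg_atTop_atBot.comp this).congr fun z ↦ ?_
    simp [neg_div]
  have h2 := (Real.tendsto_exp_atBot.comp h1).const_mul (1 / √(2 * Real.pi * t))
  rw [mul_zero] at h2
  exact h2

lemma integrable_id_gaussianReal (t : ℝ≥0) : Integrable (fun z : ℝ ↦ z) (gaussianReal 0 t) :=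
  (memLp_id_gaussianReal (μ := 0) (v := t) 1).integrable (by simp)

/-- The truncated first moment of the centered normal law of variance `t` is `t φ_t`. -/
lemma setIntegral_Ioi_id_gaussianReal {t : ℝ≥0} (ht : 0 < t) (a : ℝ) :
    ∫ z in Ioi a, z ∂(gaussianReal 0 t) = t * gaussDensity t a := by
  rw [setIntegral_gaussianReal_eq ht _ measurableSet_Ioi]
  have h0 : Tendsto (fun z ↦ -((t : ℝ) * gaussDensity t z)) atTop (𝓝 0) := by
    simpa using ((tendsto_gaussDensity_atTop (t := t) (by exact_mod_cast ht)).const_mul (t : ℝ)).neg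
  rw [integral_Ioi_of_hasDerivAt_of_tendsto'
    (fun z _ ↦ hasDerivAt_gaussDensity (by exact_mod_cast ht) z)
    (((integrable_gaussianReal_iff ht _).1 (integrable_id_gaussianReal t)).integrableOn) h0]
  ring

/-- The points `(u, (x - s u) / c)` and `(x, (u - s x) / c)` of the plane have the same norm when
`s² + c² = 1`, hence the same value of the product density. -/
lemma gaussDensity_mul_gaussDensity (t x u : ℝ) {s c : ℝ} (hc : 0 < c)
    (hsc : s ^ 2 + c ^ 2 = 1) :
    gaussDensity t u * gaussDensity t ((x - s * u) / c)
      = gaussDensity t x * gaussDensity t ((u - s * x) / c) := by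
  have hc2 : c ^ 2 = 1 - s ^ 2 := by linarith
  have key : u ^ 2 + ((x - s * u) / c) ^ 2 = x ^ 2 + ((u - s * x) / c) ^ 2 := by
    have : c ^ 2 ≠ 0 := by positivity
    rw [div_pow, div_pow]
    field_simp
    rw [hc2]
    ring
  unfold gaussDensity
  rw [mul_mul_mul_comm, mul_mul_mul_comm _ _ (1 / √(2 * Real.pi * t)), ← Real.exp_add,
    ← Real.exp_add, ← add_div, ← add_div, ← neg_add, ← neg_add, key]

lemma integral_mul_gaussDensity_comp {t : ℝ≥0} (ht : 0 < t) (k : ℝ → ℝ) (x : ℝ) {s c : ℝ}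
    (hc : 0 < c) (hsc : s ^ 2 + c ^ 2 = 1) :
    ∫ u, k u * gaussDensity t ((x - s * u) / c) ∂(gaussianReal 0 t)
      = c * gaussDensity t x * ∫ z, k (s * x + c * z) ∂(gaussianReal 0 t) := by
  rw [integral_gaussianReal_eq ht, integral_gaussianReal_eq ht]
  have h1 : ∀ u, gaussDensity t u * (k u * gaussDensity t ((x - s * u) / c))
      = gaussDensity t x * (gaussDensity t ((u - s * x) / c) * k u) := fun u ↦ by
    linear_combination k u * gaussDensity_mul_gaussDensity t x u hc hsc
  simp_rw [h1]
  rw [integral_const_mul]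
  -- substitute `u = s * x + c * z`
  have h2 : ∫ u, gaussDensity t ((u - s * x) / c) * k u
      = ∫ u, gaussDensity t (u / c) * k (s * x + c * (u / c)) := by
    rw [← integral_sub_right_eq_self (fun u ↦ gaussDensity t (u / c) * k (s * x + c * (u / c)))
      (s * x)]
    congr 1
    ext u
    congr 2
    field_simp
    ring
  rw [h2, Measure.integral_comp_div (fun z ↦ gaussDensity t z * k (s * x + c * z)) c,
    abs_of_pos hc, smul_eq_mul]
  ring

/-! ### The Mehler representation of the Stein kernel -/

/-- Rotation invariance of the law of two independent centered Gaussian variables with the same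
variance, written in coordinates. -/
lemma measurePreserving_rotation_gaussianReal (t : ℝ≥0) (θ : ℝ) :
    MeasurePreserving
      (fun p : ℝ × ℝ ↦ (Real.cos θ * p.1 + Real.sin θ * p.2, -Real.sin θ * p.1 + Real.cos θ * p.2))
      ((gaussianReal 0 t).prod (gaussianReal 0 t))
      ((gaussianReal 0 t).prod (gaussianReal 0 t)) where
  measurable := by fun_prop
  map_eq := IsGaussian.map_rotation_eq_self (by simp) θ

/-- For a rotated pair `(U, V)`, integrating out `V` in
`𝔼[k(U) V; s U + c V > x]` leaves a Gaussian expectation of `k` around `s x`. -/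
lemma integral_prod_mul_indicator {t : ℝ≥0} (ht : 0 < t) {k : ℝ → ℝ}
    (hk : Integrable k (gaussianReal 0 t)) (x : ℝ) {s c : ℝ}
    (hc : 0 < c) (hsc : s ^ 2 + c ^ 2 = 1) :
    ∫ p : ℝ × ℝ, {p : ℝ × ℝ | x < s * p.1 + c * p.2}.indicator (fun p ↦ k p.1 * p.2) p
        ∂((gaussianReal 0 t).prod (gaussianReal 0 t))
      = t * gaussDensity t x * (c * ∫ z, k (s * x + c * z) ∂(gaussianReal 0 t)) := by
  have hm : MeasurableSet {p : ℝ × ℝ | x < s * p.1 + c * p.2} :=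
    measurableSet_lt (by fun_prop) (by fun_prop)
  rw [integral_prod _ ((hk.mul_prod (integrable_id_gaussianReal t)).indicator hm)]
  have h1 : ∀ u : ℝ, ∫ w, {p : ℝ × ℝ | x < s * p.1 + c * p.2}.indicator (fun p ↦ k p.1 * p.2)
      (u, w) ∂(gaussianReal 0 t) = t * (k u * gaussDensity t ((x - s * u) / c)) := by
    intro u
    have h2 : ∀ w, {p : ℝ × ℝ | x < s * p.1 + c * p.2}.indicator (fun p ↦ k p.1 * p.2) (u, w)
        = k u * (Ioi ((x - s * u) / c)).indicator (fun w ↦ w) w := by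
      intro w
      have : x < s * u + c * w ↔ (x - s * u) / c < w := by
        rw [div_lt_iff₀ hc]
        constructor <;> intro h <;> linarith
      by_cases hw : (x - s * u) / c < w
      · have hu : (u, w) ∈ {p : ℝ × ℝ | x < s * p.1 + c * p.2} := this.2 hw
        rw [indicator_of_mem hu, indicator_of_mem (mem_Ioi.2 hw)]
      · have hu : (u, w) ∉ {p : ℝ × ℝ | x < s * p.1 + c * p.2} := fun h ↦ hw (this.1 h)
        rw [indicator_of_notMem hu, indicator_of_notMem (by simpa using hw), mul_zero]
    simp_rw [h2]
    rw [integral_const_mul, integral_indicator measurableSet_Ioi,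
      setIntegral_Ioi_id_gaussianReal ht]
    ring
  simp_rw [h1]
  rw [integral_const_mul, integral_mul_gaussDensity_comp ht k x hc hsc]
  ring

lemma integral_rotation_deriv {f : ℝ → ℝ} (hf : Differentiable ℝ f) (hf' : Continuous (deriv f))
    (y z : ℝ) :
    ∫ θ in (0 : ℝ)..(Real.pi / 2), deriv f (Real.cos θ * y + Real.sin θ * z)
        * (-Real.sin θ * y + Real.cos θ * z) = f z - f y := by
  have h : ∀ θ : ℝ, HasDerivAt (fun θ ↦ f (Real.cos θ * y + Real.sin θ * z))
      (deriv f (Real.cos θ * y + Real.sin θ * z) * (-Real.sin θ * y + Real.cos θ * z)) θ := by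
    intro θ
    exact (hf _).hasDerivAt.comp θ
      (((Real.hasDerivAt_cos θ).mul_const y).add ((Real.hasDerivAt_sin θ).mul_const z))
  rw [intervalIntegral.integral_eq_sub_of_hasDerivAt (fun θ _ ↦ h θ)
    (Continuous.intervalIntegrable (by fun_prop) _ _)]
  simp

/-- The Mehler semigroup average of `k`, which at `k = f'` is the Stein kernel of `f`
divided by `f'`, up to the factor `t`. The parameter `θ` is an angle. -/
noncomputable def mehlerAverage (t : ℝ≥0) (k : ℝ → ℝ) (x : ℝ) : ℝ :=
  ∫ θ in (0 : ℝ)..(Real.pi / 2),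
    Real.cos θ * ∫ z, k (Real.sin θ * x + Real.cos θ * z) ∂(gaussianReal 0 t)

/-- Mehler's formula. Interpolate between independent copies `Y` and `Z` along the rotation
`cos θ Y + sin θ Z`, integrate the derivative in `θ` over `{Z > x}`, and use the rotation
invariance of the Gaussian pair for each `θ`. -/
theorem setIntegral_Ioi_sub_mean_eq_mehlerAverage {t : ℝ≥0} (ht : 0 < t) {f : ℝ → ℝ}
    (hf : Differentiable ℝ f) (hf' : Continuous (deriv f))
    (hfi : Integrable f (gaussianReal 0 t)) (hfi' : Integrable (deriv f) (gaussianReal 0 t))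
    (x : ℝ) :
    ∫ z in Ioi x, (f z - ∫ y, f y ∂(gaussianReal 0 t)) ∂(gaussianReal 0 t)
      = t * gaussDensity t x * mehlerAverage t (deriv f) x := by
  set γ := gaussianReal 0 t with hγ
  set F : ℝ × ℝ → ℝ := fun p ↦ deriv f p.1 * p.2 with hF
  let R : ℝ → ℝ × ℝ → ℝ × ℝ := fun θ p ↦
    (Real.cos θ * p.1 + Real.sin θ * p.2, -Real.sin θ * p.1 + Real.cos θ * p.2)
  have hR : ∀ θ, MeasurePreserving (R θ) (γ.prod γ) (γ.prod γ) :=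
    measurePreserving_rotation_gaussianReal t
  have hFi : Integrable F (γ.prod γ) := hfi'.mul_prod (integrable_id_gaussianReal t)
  let G : ℝ → ℝ × ℝ → ℝ := fun θ p ↦ {p : ℝ × ℝ | x < p.2}.indicator (fun p ↦ F (R θ p)) p
  have hS : MeasurableSet {p : ℝ × ℝ | x < p.2} := measurableSet_lt (by fun_prop) (by fun_prop)
  have hGm : Measurable (Function.uncurry G) := by
    have h1 : Measurable (fun q : ℝ × (ℝ × ℝ) ↦ F (R q.1 q.2)) := by
      apply Continuous.measurable
      simp only [hF, R]
      fun_prop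
    have h2 : MeasurableSet {q : ℝ × (ℝ × ℝ) | x < q.2.2} :=
      measurableSet_lt (by fun_prop) (by fun_prop)
    exact h1.indicator h2
  have hGi : ∀ θ, Integrable (G θ) (γ.prod γ) := fun θ ↦
    ((hR θ).integrable_comp_of_integrable hFi).indicator hS
  -- By rotation invariance, the `L¹` norm of `G θ` is at most that of `F`, uniformly in `θ`.
  have hG : Integrable (Function.uncurry G)
      ((volume.restrict (Ioc 0 (Real.pi / 2))).prod (γ.prod γ)) := by
    rw [integrable_prod_iff hGm.aestronglyMeasurable]
    refine ⟨ae_of_all _ fun θ ↦ hGi θ, ?_⟩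
    refine Integrable.mono' (g := fun _ ↦ ∫ p, ‖F p‖ ∂(γ.prod γ)) (integrable_const _)
      hGm.aestronglyMeasurable.norm.integral_prod_right' (ae_of_all _ fun θ ↦ ?_)
    rw [Real.norm_of_nonneg (integral_nonneg fun _ ↦ norm_nonneg _)]
    have hFn : Integrable (fun p ↦ ‖F p‖) (γ.prod γ) := hFi.norm
    calc ∫ p, ‖Function.uncurry G (θ, p)‖ ∂(γ.prod γ)
        ≤ ∫ p, ‖F (R θ p)‖ ∂(γ.prod γ) := by
          refine integral_mono (hGi θ).norm ((hR θ).integrable_comp_of_integrable hFn) fun p ↦ ?_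
          exact norm_indicator_le_norm_self (fun p ↦ F (R θ p)) p
      _ = ∫ p, ‖F p‖ ∂(γ.prod γ) := by
          conv_rhs => rw [← (hR θ).map_eq]
          rw [integral_map (hR θ).measurable.aemeasurable]
          rw [(hR θ).map_eq]
          exact hFn.aestronglyMeasurable
  have hswap := integral_integral_swap hG
  have hleft : ∫ θ in Ioc 0 (Real.pi / 2), ∫ p, G θ p ∂(γ.prod γ)
      = t * gaussDensity t x * mehlerAverage t (deriv f) x := by
    rw [mehlerAverage, intervalIntegral.integral_of_le (by positivity), ← integral_const_mul,
      integral_Ioc_eq_integral_Ioo, integral_Ioc_eq_integral_Ioo]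
    refine setIntegral_congr_fun measurableSet_Ioo fun θ hθ ↦ ?_
    have hc : 0 < Real.cos θ := Real.cos_pos_of_mem_Ioo ⟨by linarith [hθ.1, Real.pi_pos], hθ.2⟩
    have hsc := Real.sin_sq_add_cos_sq θ
    change ∫ p, G θ p ∂(γ.prod γ) = t * gaussDensity t x * (_ * _)
    rw [← integral_prod_mul_indicator ht hfi' x hc hsc]
    have hm : MeasurableSet {p : ℝ × ℝ | x < Real.sin θ * p.1 + Real.cos θ * p.2} :=
      measurableSet_lt (by fun_prop) (by fun_prop)
    conv_rhs => rw [← (hR θ).map_eq]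
    rw [integral_map (hR θ).measurable.aemeasurable]
    · congr 1
      ext p
      have h2 : Real.sin θ * (R θ p).1 + Real.cos θ * (R θ p).2 = p.2 := by
        simp only [R]
        linear_combination p.2 * hsc
      by_cases hp : x < p.2
      · rw [indicator_of_mem (by simpa [h2] using hp)]
        exact indicator_of_mem (s := {p : ℝ × ℝ | x < p.2}) hp _
      · rw [indicator_of_notMem (by simpa [h2] using hp)]
        exact indicator_of_notMem (s := {p : ℝ × ℝ | x < p.2}) hp _
    · rw [(hR θ).map_eq]
      exact (hFi.indicator hm).aestronglyMeasurable
  have hin : ∀ p, ∫ θ in Ioc 0 (Real.pi / 2), G θ p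
      = {p : ℝ × ℝ | x < p.2}.indicator (fun p ↦ f p.2 - f p.1) p := by
    intro p
    by_cases hp : x < p.2
    · rw [indicator_of_mem (by exact hp), ← integral_rotation_deriv hf hf' p.1 p.2,
        intervalIntegral.integral_of_le (by positivity)]
      refine integral_congr_ae (ae_of_all _ fun θ ↦ ?_)
      exact indicator_of_mem (s := {p : ℝ × ℝ | x < p.2}) hp _
    · rw [indicator_of_notMem (by exact hp)]
      refine (integral_congr_ae (ae_of_all _ fun θ ↦ ?_)).trans (integral_zero _ _)
      exact indicator_of_notMem (s := {p : ℝ × ℝ | x < p.2}) hp _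
  have hright : ∫ p, {p : ℝ × ℝ | x < p.2}.indicator (fun p ↦ f p.2 - f p.1) p ∂(γ.prod γ)
      = ∫ z in Ioi x, (f z - ∫ y, f y ∂γ) ∂γ := by
    have hi : Integrable (fun p : ℝ × ℝ ↦ f p.2 - f p.1) (γ.prod γ) :=
      (hfi.comp_snd γ).sub (hfi.comp_fst γ)
    rw [integral_prod_symm _ (hi.indicator hS), ← integral_indicator measurableSet_Ioi]
    congr 1
    ext z
    by_cases hz : x < z
    · rw [indicator_of_mem (mem_Ioi.2 hz)]
      have : ∀ y, {p : ℝ × ℝ | x < p.2}.indicator (fun p ↦ f p.2 - f p.1) (y, z) = f z - f y :=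
        fun y ↦ indicator_of_mem (by exact hz) _
      simp_rw [this]
      rw [integral_sub (integrable_const _) hfi]
      simp
    · rw [indicator_of_notMem (by simpa using hz)]
      have : ∀ y, {p : ℝ × ℝ | x < p.2}.indicator (fun p ↦ f p.2 - f p.1) (y, z) = 0 :=
        fun y ↦ indicator_of_notMem (by exact hz) _
      simp_rw [this]
      simp
  rw [← hright, ← hleft, hswap]
  exact (integral_congr_ae (ae_of_all _ hin)).symm

/-! ### Moments and elementary power inequalities -/

lemma one_le_deltaConst (p : ℝ) : 1 ≤ deltaConst p := le_max_left _ _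

lemma deltaConst_pos (p : ℝ) : 0 < deltaConst p := one_pos.trans_le (one_le_deltaConst p)

lemma abs_add_rpow_le {p : ℝ} (hp : 0 ≤ p) (a b : ℝ) :
    |a + b| ^ p ≤ deltaConst p * (|a| ^ p + |b| ^ p) := by
  have h1 : |a + b| ≤ 2 * max |a| |b| := by
    linarith [abs_add_le a b, le_max_left |a| |b|, le_max_right |a| |b|]
  have h2 : (max |a| |b|) ^ p ≤ |a| ^ p + |b| ^ p := by
    rcases max_choice |a| |b| with h | h <;> rw [h]
    · linarith [Real.rpow_nonneg (abs_nonneg b) p]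
    · linarith [Real.rpow_nonneg (abs_nonneg a) p]
  calc |a + b| ^ p ≤ (2 * max |a| |b|) ^ p := Real.rpow_le_rpow (abs_nonneg _) h1 hp
    _ = 2 ^ p * (max |a| |b|) ^ p := Real.mul_rpow (by norm_num) (by positivity)
    _ ≤ deltaConst p * (|a| ^ p + |b| ^ p) := by
        refine mul_le_mul (le_max_right _ _) h2 (by positivity) (deltaConst_pos p).le

lemma integrable_abs_rpow_gaussianReal (t : ℝ≥0) {p : ℝ} (hp : 0 ≤ p) :
    Integrable (fun z : ℝ ↦ |z| ^ p) (gaussianReal 0 t) := by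
  have h := (memLp_id_gaussianReal' (μ := 0) (v := t) (ENNReal.ofReal p)
    ENNReal.ofReal_ne_top).integrable_norm_rpow'
  simpa [ENNReal.toReal_ofReal hp] using h

lemma integral_abs_rpow_gaussianReal {t : ℝ≥0} (ht : 0 < t) {p : ℝ} (hp : 0 ≤ p) :
    ∫ z, |z| ^ p ∂(gaussianReal 0 t) = xiConst t p := by
  have ht' : (0 : ℝ) < t := by exact_mod_cast ht
  rw [integral_gaussianReal_eq ht]
  have h1 : ∀ z : ℝ, gaussDensity t z * |z| ^ p
      = (fun x : ℝ ↦ 1 / √(2 * Real.pi * t)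
          * (x ^ p * Real.exp (-(1 / (2 * (t : ℝ))) * x ^ (2 : ℝ)))) |z| := by
    intro z
    have : -(1 / (2 * (t : ℝ))) * |z| ^ (2 : ℝ) = -z ^ 2 / (2 * t) := by
      rw [Real.rpow_two, sq_abs]
      ring
    simp only [gaussDensity, this]
    ring
  simp_rw [h1]
  rw [integral_comp_abs (f := fun x : ℝ ↦ 1 / √(2 * Real.pi * t)
      * (x ^ p * Real.exp (-(1 / (2 * (t : ℝ))) * x ^ (2 : ℝ)))), integral_const_mul,
    integral_rpow_mul_exp_neg_mul_rpow (by norm_num) (by linarith) (by positivity)]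
  have h2 : (1 / (2 * (t : ℝ))) ^ (-(p + 1) / 2) = (2 * t) ^ (p / 2) * √(2 * t) := by
    rw [one_div, Real.inv_rpow (by positivity), ← Real.rpow_neg (by positivity),
      Real.sqrt_eq_rpow, ← Real.rpow_add (by positivity)]
    congr 1
    ring
  have h3 : √(2 * Real.pi * t) = √(2 * t) * √Real.pi := by
    rw [← Real.sqrt_mul (by positivity)]
    congr 1
    ring
  have h4 : √(2 * (t : ℝ)) ≠ 0 := by positivity
  rw [h2, h3, xiConst, add_comm p 1]
  field_simp

lemma integral_cos_mul_sin_rpow {p : ℝ} (hp : 0 ≤ p) :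
    ∫ θ in (0 : ℝ)..(Real.pi / 2), Real.cos θ * Real.sin θ ^ p = (1 + p)⁻¹ := by
  have hd : ∀ θ : ℝ, HasDerivAt (fun θ ↦ Real.sin θ ^ (p + 1) * (1 + p)⁻¹)
      (Real.cos θ * Real.sin θ ^ p) θ := by
    intro θ
    convert! (((Real.hasDerivAt_sin θ).rpow_const (p := p + 1)
      (Or.inr (by linarith))).mul_const (1 + p)⁻¹) using 1
    rw [add_sub_cancel_right]
    field_simp
    ring
  have hc : Continuous fun θ : ℝ ↦ Real.cos θ * Real.sin θ ^ p :=
    Real.continuous_cos.mul (Real.continuous_sin.rpow_const fun _ ↦ Or.inr hp)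
  rw [intervalIntegral.integral_eq_sub_of_hasDerivAt (fun θ _ ↦ hd θ) (hc.intervalIntegrable _ _)]
  simp [Real.zero_rpow (by linarith : p + 1 ≠ 0)]

/-! ### Two-sided bounds on the Mehler average -/

section MehlerBounds

variable {t : ℝ≥0} {k : ℝ → ℝ} {C p : ℝ}

/-- The majorant of `k (sin θ x + cos θ z)` that separates `x` from `z`. -/
lemma le_of_growth_rotation (hp : 0 ≤ p) (hC : 0 ≤ C) (hk : ∀ x, |k x| ≤ C * (1 + |x| ^ p))
    (θ x z : ℝ) :
    |k (Real.sin θ * x + Real.cos θ * z)|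
      ≤ C * (1 + deltaConst p * (|Real.sin θ| ^ p * |x| ^ p + |z| ^ p)) := by
  refine (hk _).trans (mul_le_mul_of_nonneg_left (add_le_add_right ?_ 1) hC)
  refine (abs_add_rpow_le hp _ _).trans (mul_le_mul_of_nonneg_left ?_ (deltaConst_pos p).le)
  rw [abs_mul, Real.mul_rpow (abs_nonneg _) (abs_nonneg _)]
  refine add_le_add_right (Real.rpow_le_rpow (abs_nonneg _) ?_ hp) _
  rw [abs_mul]
  exact mul_le_of_le_one_left (abs_nonneg z) (Real.abs_cos_le_one θ)

lemma integrable_growth_majorant (t : ℝ≥0) (hp : 0 ≤ p) (C B : ℝ) :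
    Integrable (fun z : ℝ ↦ C * (1 + deltaConst p * (B + |z| ^ p))) (gaussianReal 0 t) :=
  ((integrable_const 1).add (((integrable_const B).add
    (integrable_abs_rpow_gaussianReal t hp)).const_mul (deltaConst p))).const_mul C

lemma integrable_rotation_of_growth (t : ℝ≥0) (hkc : Continuous k) (hp : 0 ≤ p) (hC : 0 ≤ C)
    (hk : ∀ x, |k x| ≤ C * (1 + |x| ^ p)) (θ x : ℝ) :
    Integrable (fun z ↦ k (Real.sin θ * x + Real.cos θ * z)) (gaussianReal 0 t) :=
  (integrable_growth_majorant t hp C (|Real.sin θ| ^ p * |x| ^ p)).mono'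
    (Continuous.aestronglyMeasurable (by fun_prop))
    (ae_of_all _ fun z ↦ le_of_growth_rotation hp hC hk θ x z)

lemma integrable_of_growth (t : ℝ≥0) (hkc : Continuous k) (hp : 0 ≤ p) (hC : 0 ≤ C)
    (hk : ∀ x, |k x| ≤ C * (1 + |x| ^ p)) : Integrable k (gaussianReal 0 t) := by
  simpa using integrable_rotation_of_growth t hkc hp hC hk 0 0

lemma continuous_mehler_integrand (t : ℝ≥0) (hkc : Continuous k) (hp : 0 ≤ p) (hC : 0 ≤ C)
    (hk : ∀ x, |k x| ≤ C * (1 + |x| ^ p)) (x : ℝ) :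
    Continuous fun θ ↦ Real.cos θ *
      ∫ z, k (Real.sin θ * x + Real.cos θ * z) ∂(gaussianReal 0 t) := by
  refine Real.continuous_cos.mul ?_
  refine continuous_of_dominated
    (bound := fun z ↦ C * (1 + deltaConst p * (|x| ^ p + |z| ^ p)))
    (fun θ ↦ Continuous.aestronglyMeasurable (by fun_prop))
    (fun θ ↦ ae_of_all _ fun z ↦ (le_of_growth_rotation hp hC hk θ x z).trans ?_)
    (integrable_growth_majorant t hp C _) (ae_of_all _ fun z ↦ by fun_prop)
  have h1 : |Real.sin θ| ^ p ≤ 1 :=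
    Real.rpow_le_one (abs_nonneg _) (Real.abs_sin_le_one θ) hp
  have h2 := deltaConst_pos p
  gcongr
  exact mul_le_of_le_one_left (by positivity) h1

lemma cos_nonneg_of_mem_Icc_zero {θ : ℝ} (hθ : θ ∈ Icc 0 (Real.pi / 2)) : 0 ≤ Real.cos θ :=
  Real.cos_nonneg_of_mem_Icc ⟨by linarith [hθ.1, Real.pi_pos], hθ.2⟩

lemma mehlerAverage_le (ht : 0 < t) (hkc : Continuous k) (hp : 0 ≤ p) (hC : 0 ≤ C)
    (hk : ∀ x, |k x| ≤ C * (1 + |x| ^ p)) (x : ℝ) :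
    mehlerAverage t k x
      ≤ C * (1 + deltaConst p * xiConst t p + deltaConst p / (1 + p) * |x| ^ p) := by
  have hsin : Continuous fun θ : ℝ ↦ Real.cos θ * Real.sin θ ^ p :=
    Real.continuous_cos.mul (Real.continuous_sin.rpow_const fun _ ↦ Or.inr hp)
  -- The cosine weight integrates to `1`, and to `1 / (1 + p)` against `sin θ ^ p`.
  have hle : mehlerAverage t k x ≤ ∫ θ in (0 : ℝ)..(Real.pi / 2),
      (C * (1 + deltaConst p * xiConst t p) * Real.cos θ
        + C * deltaConst p * |x| ^ p * (Real.cos θ * Real.sin θ ^ p)) := by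
    refine intervalIntegral.integral_mono_on (by positivity)
      ((continuous_mehler_integrand t hkc hp hC hk x).intervalIntegrable _ _)
      (Continuous.intervalIntegrable (by fun_prop) _ _) fun θ hθ ↦ ?_
    have hs : 0 ≤ Real.sin θ :=
      Real.sin_nonneg_of_nonneg_of_le_pi hθ.1 (by linarith [hθ.2, Real.pi_pos])
    have h1 : ∫ z, k (Real.sin θ * x + Real.cos θ * z) ∂(gaussianReal 0 t)
        ≤ C * (1 + deltaConst p * (|Real.sin θ| ^ p * |x| ^ p + xiConst t p)) := by
      calc ∫ z, k (Real.sin θ * x + Real.cos θ * z) ∂(gaussianReal 0 t)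
          ≤ ∫ z, C * (1 + deltaConst p * (|Real.sin θ| ^ p * |x| ^ p + |z| ^ p))
              ∂(gaussianReal 0 t) :=
            integral_mono (integrable_rotation_of_growth t hkc hp hC hk θ x)
              (integrable_growth_majorant t hp C _)
              fun z ↦ (le_abs_self _).trans (le_of_growth_rotation hp hC hk θ x z)
        _ = _ := by
            have hi := integrable_abs_rpow_gaussianReal t hp
            have hi' : Integrable
                (fun z : ℝ ↦ deltaConst p * (|Real.sin θ| ^ p * |x| ^ p + |z| ^ p))
                (gaussianReal 0 t) := ((integrable_const _).add hi).const_mul _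
            rw [integral_const_mul, integral_add (integrable_const _) hi', integral_const_mul,
              integral_add (integrable_const _) hi, integral_abs_rpow_gaussianReal ht hp]
            simp
    refine (mul_le_mul_of_nonneg_left h1 (cos_nonneg_of_mem_Icc_zero hθ)).trans_eq ?_
    rw [abs_of_nonneg hs]
    ring
  refine hle.trans_eq ?_
  rw [intervalIntegral.integral_add (Continuous.intervalIntegrable (by fun_prop) _ _)
    (Continuous.intervalIntegrable (by fun_prop) _ _), intervalIntegral.integral_const_mul,
    intervalIntegral.integral_const_mul, integral_cos_mul_sin_rpow hp, integral_cos]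
  simp
  ring

lemma muConst_eq_integral (ht : 0 < t) (q : ℝ) :
    muConst t q = ∫ z, (1 + |z| ^ q)⁻¹ ∂(gaussianReal 0 t) := by
  rw [integral_gaussianReal_eq ht]
  rfl

lemma integrable_inv_one_add_abs_rpow (t : ℝ≥0) (q : ℝ) :
    Integrable (fun z : ℝ ↦ (1 + |z| ^ q)⁻¹) (gaussianReal 0 t) := by
  refine Integrable.mono' (g := fun _ ↦ (1 : ℝ)) (integrable_const _)
    (Measurable.aestronglyMeasurable (by fun_prop)) (ae_of_all _ fun z ↦ ?_)
  have h : 0 ≤ |z| ^ q := by positivity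
  rw [Real.norm_of_nonneg (by positivity)]
  exact inv_le_one_of_one_le₀ (by linarith)

lemma muConst_pos (ht : 0 < t) (q : ℝ) : 0 < muConst t q := by
  rw [muConst_eq_integral ht, integral_pos_iff_support_of_nonneg (fun z ↦ by positivity)
    (integrable_inv_one_add_abs_rpow t q)]
  have : Function.support (fun z : ℝ ↦ (1 + |z| ^ q)⁻¹) = univ := by
    ext z
    have : (1 + |z| ^ q)⁻¹ ≠ 0 := by positivity
    simpa using this
  simp [this]

lemma le_mehlerAverage (ht : 0 < t) (hkc : Continuous k) (hp : 0 ≤ p) (hC : 0 ≤ C)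
    (hk : ∀ x, |k x| ≤ C * (1 + |x| ^ p)) {K q : ℝ} (hq : 0 ≤ q) (hK : 0 < K)
    (hlow : ∀ x, (K * (1 + |x| ^ q))⁻¹ ≤ k x) (x : ℝ) :
    muConst t q / (K * deltaConst q * (1 + |x| ^ q)) ≤ mehlerAverage t k x := by
  have hδ := deltaConst_pos q
  have hle : ∫ θ in (0 : ℝ)..(Real.pi / 2),
      Real.cos θ * (muConst t q / (K * deltaConst q * (1 + |x| ^ q))) ≤ mehlerAverage t k x := by
    refine intervalIntegral.integral_mono_on (by positivity)
      (Continuous.intervalIntegrable (by fun_prop) _ _)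
      ((continuous_mehler_integrand t hkc hp hC hk x).intervalIntegrable _ _) fun θ hθ ↦ ?_
    refine mul_le_mul_of_nonneg_left ?_ (cos_nonneg_of_mem_Icc_zero hθ)
    rw [muConst_eq_integral ht, div_eq_inv_mul, ← integral_const_mul]
    refine integral_mono ((integrable_inv_one_add_abs_rpow t q).const_mul _)
      (integrable_rotation_of_growth t hkc hp hC hk θ x) fun z ↦ le_trans ?_ (hlow _)
    have h1 : |Real.sin θ * x + Real.cos θ * z| ^ q ≤ deltaConst q * (|x| ^ q + |z| ^ q) := by
      refine (abs_add_rpow_le hq _ _).trans (mul_le_mul_of_nonneg_left ?_ hδ.le)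
      rw [abs_mul, abs_mul]
      gcongr
      · exact mul_le_of_le_one_left (abs_nonneg x) (Real.abs_sin_le_one θ)
      · exact mul_le_of_le_one_left (abs_nonneg z) (Real.abs_cos_le_one θ)
    have hx : 0 ≤ |x| ^ q := by positivity
    have hz : 0 ≤ |z| ^ q := by positivity
    have h2 : 1 + |Real.sin θ * x + Real.cos θ * z| ^ q
        ≤ deltaConst q * ((1 + |x| ^ q) * (1 + |z| ^ q)) := by
      have h3 : 0 ≤ deltaConst q * (|x| ^ q * |z| ^ q) := by positivity
      linarith [one_le_deltaConst q]
    rw [← mul_inv]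
    refine inv_anti₀ (by positivity) ?_
    calc K * (1 + |Real.sin θ * x + Real.cos θ * z| ^ q)
        ≤ K * (deltaConst q * ((1 + |x| ^ q) * (1 + |z| ^ q))) := by gcongr
      _ = _ := by ring
  refine le_trans (le_of_eq ?_) hle
  rw [intervalIntegral.integral_mul_const, integral_cos]
  simp

/-! ### Polynomial bounds on the Stein kernel -/

lemma mul_mehlerAverage_le (ht : 0 < t) (hkc : Continuous k) (hp : 0 ≤ p) (hC : 0 ≤ C)
    (hk : ∀ x, |k x| ≤ C * (1 + |x| ^ p)) (hk0 : ∀ x, 0 ≤ k x) (x : ℝ) :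
    k x * mehlerAverage t k x ≤ C ^ 2 * bigDConst t p * (1 + |x| ^ (2 * p)) := by
  set X := |x| ^ p with hX
  have hX0 : 0 ≤ X := by positivity
  have hX2 : |x| ^ (2 * p) = X ^ 2 := by
    rw [hX, mul_comm, Real.rpow_mul (abs_nonneg x), Real.rpow_two]
  have hδ := deltaConst_pos p
  have hΞ : 0 ≤ xiConst t p := by
    rw [← integral_abs_rpow_gaussianReal ht hp]
    exact integral_nonneg fun z ↦ by positivity
  have h1 : k x ≤ C * (1 + X) := (le_abs_self _).trans (hk x)
  have h2 := mehlerAverage_le ht hkc hp hC hk x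
  have hb1 : 1 + deltaConst p * xiConst t p
      + (1 + deltaConst p * (xiConst t p + (1 + p)⁻¹)) ^ 2 / 2 ≤ bigDConst t p := le_max_left _ _
  have hb2 : 1 / 2 + deltaConst p / (1 + p) ≤ bigDConst t p := le_max_right _ _
  calc k x * mehlerAverage t k x
      ≤ (C * (1 + X))
          * (C * (1 + deltaConst p * xiConst t p + deltaConst p / (1 + p) * X)) :=
        (mul_le_mul_of_nonneg_left h2 (hk0 x)).trans
          (mul_le_mul_of_nonneg_right h1 (by positivity))
    _ = C ^ 2 * ((1 + X) * (1 + deltaConst p * xiConst t p + deltaConst p / (1 + p) * X)) := by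
        ring
    _ ≤ C ^ 2 * (bigDConst t p * (1 + X ^ 2)) := by
        refine mul_le_mul_of_nonneg_left ?_ (sq_nonneg C)
        -- Young's inequality on the cross term
        have hy := sq_nonneg (1 + deltaConst p * (xiConst t p + (1 + p)⁻¹) - X)
        have hb3 := mul_le_mul_of_nonneg_right hb2 (sq_nonneg X)
        simp only [div_eq_mul_inv] at hb1 hb3 ⊢
        linarith
    _ = _ := by rw [hX2]; ring

lemma le_mul_mehlerAverage (ht : 0 < t) (hkc : Continuous k) (hp : 0 ≤ p) (hC : 0 ≤ C)
    (hk : ∀ x, |k x| ≤ C * (1 + |x| ^ p)) {K q : ℝ} (hq : 0 ≤ q) (hK : 0 < K)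
    (hlow : ∀ x, (K * (1 + |x| ^ q))⁻¹ ≤ k x) (x : ℝ) :
    muConst t q / (2 * deltaConst q * K ^ 2 * (1 + |x| ^ (2 * q))) ≤ k x * mehlerAverage t k x := by
  have hX2 : |x| ^ (2 * q) = (|x| ^ q) ^ 2 := by
    rw [mul_comm, Real.rpow_mul (abs_nonneg x), Real.rpow_two]
  have hδ := deltaConst_pos q
  have hμ := muConst_pos ht q
  have hX0 : 0 ≤ |x| ^ q := by positivity
  calc muConst t q / (2 * deltaConst q * K ^ 2 * (1 + |x| ^ (2 * q)))
      ≤ muConst t q / (deltaConst q * K ^ 2 * (1 + |x| ^ q) ^ 2) := by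
        gcongr muConst t q / ?_
        rw [hX2]
        have h : (1 + |x| ^ q) ^ 2 ≤ 2 * (1 + (|x| ^ q) ^ 2) := by
          linarith [sq_nonneg (1 - |x| ^ q)]
        calc deltaConst q * K ^ 2 * (1 + |x| ^ q) ^ 2
            ≤ deltaConst q * K ^ 2 * (2 * (1 + (|x| ^ q) ^ 2)) := by gcongr
          _ = _ := by ring
    _ = (K * (1 + |x| ^ q))⁻¹ * (muConst t q / (K * deltaConst q * (1 + |x| ^ q))) := by
        field_simp
    _ ≤ k x * mehlerAverage t k x := by
        refine mul_le_mul (hlow x) (le_mehlerAverage ht hkc hp hC hk hq hK hlow x)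
          (by positivity) (le_trans (by positivity) (hlow x))

end MehlerBounds

lemma abs_le_growthConst {f : ℝ → ℝ} {p : ℝ} (hf : BddAbove (range (growthQuotient f p))) (x : ℝ) :
    |f x| ≤ growthConst f p * (1 + |x| ^ p) := by
  have h : growthQuotient f p x ≤ growthConst f p := le_ciSup hf x
  rwa [growthQuotient, div_le_iff₀ (by positivity)] at h

lemma growthConst_nonneg (f : ℝ → ℝ) (p : ℝ) : 0 ≤ growthConst f p :=
  Real.iSup_nonneg fun x ↦ by
    unfold growthQuotient
    positivity

/-- Composition of growth bounds: if `|x| ≤ C (1 + |y|^r)` then `|x|^s` grows at most like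
`|y|^{s r}`. -/
lemma abs_rpow_le_of_growth {x y C r s : ℝ} (hs : 0 ≤ s) (hC : 0 ≤ C)
    (h : |x| ≤ C * (1 + |y| ^ r)) :
    |x| ^ s ≤ C ^ s * deltaConst s * (1 + |y| ^ (s * r)) := by
  have h1 : (1 + |y| ^ r) ^ s ≤ deltaConst s * (1 + |y| ^ (s * r)) := by
    have h2 := abs_add_rpow_le hs 1 (|y| ^ r)
    rwa [abs_of_nonneg (by positivity : 0 ≤ 1 + |y| ^ r), abs_one, Real.one_rpow,
      abs_of_nonneg (by positivity : 0 ≤ |y| ^ r), ← Real.rpow_mul (abs_nonneg y),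
      mul_comm r s] at h2
  calc |x| ^ s ≤ (C * (1 + |y| ^ r)) ^ s := Real.rpow_le_rpow (abs_nonneg x) h hs
    _ = C ^ s * (1 + |y| ^ r) ^ s := Real.mul_rpow hC (by positivity)
    _ ≤ C ^ s * (deltaConst s * (1 + |y| ^ (s * r))) := by gcongr
    _ = _ := by ring

/-! ### Growth rates -/

lemma bddAbove_range_of_eventually_le {h : ℝ → ℝ} (hc : Continuous h) {c : ℝ}
    (he : ∀ᶠ x in cocompact ℝ, h x ≤ c) : BddAbove (range h) := by
  obtain ⟨s, hs, hsc⟩ := mem_cocompact.1 he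
  obtain ⟨d, hd⟩ := hs.exists_bound_of_continuousOn hc.continuousOn
  refine ⟨max c d, ?_⟩
  rintro _ ⟨x, rfl⟩
  by_cases hx : x ∈ s
  · exact ((le_abs_self _).trans (hd x hx)).trans (le_max_right _ _)
  · exact (hsc hx : h x ≤ c).trans (le_max_left _ _)

lemma eventually_one_le_abs : ∀ᶠ x : ℝ in cocompact ℝ, 1 ≤ |x| :=
  (tendsto_norm_cocompact_atTop (E := ℝ)).eventually_ge_atTop 1

/-- Above its upper growth rate a continuous function has a finite growth constant. -/
lemma bddAbove_growthQuotient {f : ℝ → ℝ} (hf : Continuous f) (hfin : upperGrowthRate f < ⊤)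
    {ε : ℝ} (hε : 0 < ε) :
    BddAbove (range (growthQuotient f ((upperGrowthRate f).toReal + ε))) := by
  set p := (upperGrowthRate f).toReal + ε with hp
  have hp0 : 0 ≤ p := add_nonneg ENNReal.toReal_nonneg hε.le
  have hlt : upperGrowthRate f < ENNReal.ofReal p := by
    rw [← ENNReal.toReal_lt_toReal hfin.ne ENNReal.ofReal_ne_top, ENNReal.toReal_ofReal hp0]
    linarith
  obtain ⟨_, ⟨α, hα, rfl, hlim⟩, hαp⟩ := sInf_lt_iff.1 hlt
  have hαp' : α ≤ p := ((ENNReal.ofReal_lt_ofReal_iff_of_nonneg hα.le).1 hαp).le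
  obtain ⟨c, hc, -⟩ := ENNReal.lt_iff_exists_nnreal_btwn.1 hlim
  have he := eventually_lt_of_limsup_lt hc
  rw [← cocompact_eq_atBot_atTop] at he
  refine bddAbove_range_of_eventually_le (c := c) ?_ ?_
  · unfold growthQuotient
    refine hf.abs.div₀ (continuous_const.add (continuous_abs.rpow_const fun _ ↦ Or.inr hp0))
      fun x ↦ ?_
    positivity
  · filter_upwards [he, eventually_one_le_abs] with x hx hx1
    have h1 : |f x| / |x| ^ α ≤ c := by
      have := (ENNReal.ofReal_lt_iff_lt_toReal (by positivity) ENNReal.coe_ne_top).1 hx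
      simpa using this.le
    rw [div_le_iff₀ (by positivity)] at h1
    rw [growthQuotient, div_le_iff₀ (by positivity)]
    have h2 : |x| ^ α ≤ |x| ^ p := Real.rpow_le_rpow_of_exponent_le hx1 hαp'
    calc |f x| ≤ c * |x| ^ α := h1
      _ ≤ c * (1 + |x| ^ p) := by
        gcongr
        linarith

/-- If `f` eventually dominates some positive power, a proper right inverse of `f` has
at most polynomial growth. -/
lemma upperGrowthRate_lt_top_of_rightInverse {f g : ℝ → ℝ} (hfg : Function.RightInverse g f)
    (hg : Tendsto g (cocompact ℝ) (cocompact ℝ)) (hlow : 0 < lowerGrowthRate f) :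
    upperGrowthRate g < ⊤ := by
  obtain ⟨α, hα0, hα⟩ := ENNReal.lt_iff_exists_nnreal_btwn.1 hlow
  have hα0' : (0 : ℝ) < α := by exact_mod_cast hα0
  have hlim : 1 < liminf (fun x : ℝ ↦ ENNReal.ofReal (|f x| / |x| ^ (α : ℝ))) (atBot ⊔ atTop) := by
    by_contra hcon
    have hmem : lowerGrowthRate f ≤ ENNReal.ofReal α :=
      sInf_le ⟨α, hα0', rfl, (not_lt.1 hcon).trans_lt ENNReal.one_lt_top⟩
    rw [ENNReal.ofReal_coe_nnreal] at hmem
    exact hα.not_ge hmem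
  have he := eventually_lt_of_lt_liminf hlim
  rw [← cocompact_eq_atBot_atTop] at he
  refine lt_of_le_of_lt (sInf_le ⟨(α : ℝ)⁻¹, inv_pos.2 hα0', rfl, ?_⟩) ENNReal.ofReal_lt_top
  refine lt_of_le_of_lt (limsup_le_of_le (a := 1) (by isBoundedDefault) ?_) ENNReal.one_lt_top
  rw [← cocompact_eq_atBot_atTop]
  filter_upwards [hg.eventually he, hg.eventually eventually_one_le_abs] with y hy hy1
  rw [hfg y, ← ENNReal.ofReal_one, ENNReal.ofReal_lt_ofReal_iff_of_nonneg zero_le_one,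
    one_lt_div (by positivity)] at hy
  rw [ENNReal.ofReal_le_one]
  refine div_le_one_of_le₀ ?_ (by positivity)
  calc |g y| = (|g y| ^ (α : ℝ)) ^ (α : ℝ)⁻¹ := (Real.rpow_rpow_inv (abs_nonneg _) hα0'.ne').symm
    _ ≤ |y| ^ (α : ℝ)⁻¹ := Real.rpow_le_rpow (by positivity) hy.le (by positivity)

/-! ### Monotone images of the Gaussian law -/

lemma bijective_of_deriv_pos {f : ℝ → ℝ} (hf : Differentiable ℝ f) (hpos : ∀ x, 0 < deriv f x)
    (habove : ¬ BddAbove (range f)) (hbelow : ¬ BddBelow (range f)) : Function.Bijective f := by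
  have hmono : StrictMono f := strictMono_of_deriv_pos hpos
  refine ⟨hmono.injective, hf.continuous.surjective ?_ ?_⟩
  · exact tendsto_atTop_atTop_of_monotone' hmono.monotone habove
  · exact tendsto_atBot_atBot_of_monotone' hmono.monotone hbelow

lemma exists_homeomorph_of_deriv_pos {f : ℝ → ℝ} (hpos : ∀ x, 0 < deriv f x)
    (hbij : Function.Bijective f) :
    ∃ e : ℝ ≃ₜ ℝ, (∀ x, e x = f x) ∧ ∀ y, e.symm y = Function.invFun f y := by
  have hmono : StrictMono f := strictMono_of_deriv_pos hpos
  let e := (hmono.orderIsoOfSurjective f hbij.surjective).toHomeomorph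
  have he : ∀ x, e x = f x := fun x ↦ rfl
  refine ⟨e, he, fun y ↦ hbij.injective ?_⟩
  rw [Function.rightInverse_invFun hbij.surjective y, ← he, e.apply_symm_apply]

section Density

variable {t : ℝ≥0} {f g : ℝ → ℝ}

/-- The density of the image of the centered normal law under the increasing diffeomorphism `f`
with inverse `g`. -/
noncomputable def imageDensity (t : ℝ≥0) (f g : ℝ → ℝ) (y : ℝ) : ℝ :=
  (deriv f (g y))⁻¹ * gaussDensity t (g y)

/-- The Stein kernel of the image of the centered normal law under the increasing
diffeomorphism `f` with inverse `g`, in Mehler form. -/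
noncomputable def imageSteinKernel (t : ℝ≥0) (f g : ℝ → ℝ) (y : ℝ) : ℝ :=
  t * (deriv f (g y) * mehlerAverage t (deriv f) (g y))

lemma imageDensity_pos (ht : 0 < t) (hpos : ∀ x, 0 < deriv f x) (y : ℝ) :
    0 < imageDensity t f g y :=
  mul_pos (inv_pos.2 (hpos _)) (gaussDensity_pos ht _)

lemma continuous_imageDensity (hf' : Continuous (deriv f)) (hpos : ∀ x, 0 < deriv f x)
    (hg : Continuous g) : Continuous (imageDensity t f g) :=
  ((hf'.comp hg).inv₀ fun y ↦ (hpos (g y)).ne').mul ((continuous_gaussDensity t).comp hg)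

lemma hasDerivAt_inverse (hf : Differentiable ℝ f) (hpos : ∀ x, 0 < deriv f x)
    (hg : Continuous g) (hfg : Function.RightInverse g f) (y : ℝ) :
    HasDerivAt g (deriv f (g y))⁻¹ y :=
  HasDerivAt.of_local_left_inverse hg.continuousAt (hf _).hasDerivAt (hpos _).ne'
    (Eventually.of_forall hfg)

lemma map_gaussianReal_eq_withDensity (ht : 0 < t) (hf : Differentiable ℝ f)
    (hpos : ∀ x, 0 < deriv f x) (hg : Continuous g)
    (hfg : Function.RightInverse g f) (hgf : Function.LeftInverse g f) :
    (gaussianReal 0 t).map f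
      = volume.withDensity (fun y ↦ ENNReal.ofReal (imageDensity t f g y)) := by
  ext s hs
  have himage : f ⁻¹' s = g '' s := (congrFun (image_eq_preimage_of_inverse hfg hgf) s).symm
  rw [Measure.map_apply hf.continuous.measurable hs, withDensity_apply _ hs, himage,
    gaussianReal_apply _ ht.ne',
    lintegral_image_eq_lintegral_abs_deriv_mul hs
      (fun y _ ↦ (hasDerivAt_inverse hf hpos hg hfg y).hasDerivWithinAt)
      (hfg.injective.injOn)]
  refine lintegral_congr fun y ↦ ?_
  rw [gaussianPDF_def, ← ENNReal.ofReal_mul (abs_nonneg _), imageDensity,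
    abs_of_pos (inv_pos.2 (hpos _)), gaussDensity_eq_gaussianPDFReal]

lemma hasDerivAt_integral_Ioi {k : ℝ → ℝ} (hk : Continuous k) (hki : Integrable k) (x : ℝ) :
    HasDerivAt (fun x ↦ ∫ z in Ioi x, k z) (-k x) x := by
  have h1 : (fun x ↦ ∫ z in Ioi x, k z) = fun x ↦ (∫ z in Ioi 0, k z) - ∫ z in (0 : ℝ)..x, k z := by
    ext x
    rw [← intervalIntegral.integral_Ioi_sub_Ioi' hki.integrableOn hki.integrableOn]
    ring
  rw [h1]
  exact ((hk.integral_hasStrictDerivAt 0 x).hasDerivAt).const_sub _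

/-- The tail integral of `f - m` beyond the level point `g m`, where `f - m` changes sign, is half
the mean absolute deviation. -/
lemma setIntegral_Ioi_sub_mean_eq_half (hmono : StrictMono f) (hfg : Function.RightInverse g f)
    (hfi : Integrable f (gaussianReal 0 t)) {m : ℝ} (hm : m = ∫ z, f z ∂(gaussianReal 0 t)) :
    ∫ z in Ioi (g m), (f z - m) ∂(gaussianReal 0 t)
      = (∫ z, |f z - m| ∂(gaussianReal 0 t)) / 2 := by
  have hi : Integrable (fun z ↦ f z - m) (gaussianReal 0 t) := hfi.sub (integrable_const m)
  have h0 : ∫ z, (f z - m) ∂(gaussianReal 0 t) = 0 := by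
    rw [integral_sub hfi (integrable_const m), ← hm]
    simp
  have h1 : ∀ z, (Ioi (g m)).indicator (fun z ↦ f z - m) z = (|f z - m| + (f z - m)) / 2 := by
    intro z
    by_cases hz : g m < z
    · have : m < f z := by simpa [hfg m] using hmono hz
      rw [indicator_of_mem (mem_Ioi.2 hz), abs_of_pos (by linarith)]
      ring
    · have : f z ≤ m := by simpa [hfg m] using hmono.monotone (not_lt.1 hz)
      rw [indicator_of_notMem (by simpa using hz), abs_of_nonpos (by linarith)]
      ring
  rw [← integral_indicator measurableSet_Ioi]
  simp_rw [h1]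
  rw [integral_div, integral_add hi.abs hi, h0, add_zero]

/-- The Nourdin–Viens density formula. The product `h ρ` of the Stein kernel and the density is the
tail integral of `x - m`, so its logarithmic derivative is `-(y - m) / h y`. -/
theorem imageDensity_eq_exp_steinKernel (ht : 0 < t) (hf : Differentiable ℝ f)
    (hf' : Continuous (deriv f)) (hpos : ∀ x, 0 < deriv f x)
    (hg : Continuous g) (hfg : Function.RightInverse g f)
    (hfi : Integrable f (gaussianReal 0 t)) (hfi' : Integrable (deriv f) (gaussianReal 0 t))
    (hR : ∀ x, 0 < mehlerAverage t (deriv f) x)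
    {m A : ℝ} (hm : m = ∫ z, f z ∂(gaussianReal 0 t))
    (hA : A = ∫ z, |f z - m| ∂(gaussianReal 0 t)) :
    Continuous (imageSteinKernel t f g) ∧ ∀ y, imageDensity t f g y
      = A / 2 / imageSteinKernel t f g y
          * Real.exp (-∫ u in (0 : ℝ)..(y - m), u / imageSteinKernel t f g (u + m)) := by
  have ht' : (0 : ℝ) < t := by exact_mod_cast ht
  have hρ := imageDensity_pos (g := g) ht hpos
  set h := imageSteinKernel t f g with hh
  set B : ℝ → ℝ := fun x ↦ ∫ z in Ioi x, (f z - m) ∂(gaussianReal 0 t) with hB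
  have hBR : ∀ x, B x = t * gaussDensity t x * mehlerAverage t (deriv f) x := fun x ↦ by
    rw [hB, hm]
    exact setIntegral_Ioi_sub_mean_eq_mehlerAverage ht hf hf' hfi hfi' x
  have hBpos : ∀ x, 0 < B x := fun x ↦ by
    rw [hBR]
    exact mul_pos (mul_pos ht' (gaussDensity_pos ht x)) (hR x)
  have hBd : ∀ x, HasDerivAt B (-(gaussDensity t x * (f x - m))) x := by
    intro x
    have hfc := hf.continuous
    have hφ := continuous_gaussDensity t
    have h1 : B = fun x ↦ ∫ z in Ioi x, gaussDensity t z * (f z - m) := by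
      ext x
      exact setIntegral_gaussianReal_eq ht _ measurableSet_Ioi
    rw [h1]
    exact hasDerivAt_integral_Ioi (by fun_prop)
      ((integrable_gaussianReal_iff ht _).1 (hfi.sub (integrable_const m))) x
  have hBh : ∀ y, B (g y) = h y * imageDensity t f g y := fun y ↦ by
    rw [hBR, hh, imageSteinKernel, imageDensity]
    field_simp [(hpos (g y)).ne']
  have hhpos : ∀ y, 0 < h y := fun y ↦ mul_pos ht' (mul_pos (hpos _) (hR _))
  have hhc : Continuous h := by
    have hBc : Continuous B := continuous_iff_continuousAt.2 fun x ↦ (hBd x).continuousAt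
    have : h = fun y ↦ B (g y) / imageDensity t f g y := by
      ext y
      rw [hBh, mul_div_cancel_right₀ _ (hρ y).ne']
    rw [this]
    exact (hBc.comp hg).div₀ (continuous_imageDensity hf' hpos hg) fun y ↦ (hρ y).ne'
  refine ⟨hhc, fun y ↦ ?_⟩
  have hlog : ∀ u, HasDerivAt (fun u ↦ Real.log (B (g (u + m)))) (-(u / h (u + m))) u := by
    intro u
    have h2 := (((hBd _).comp (u + m) (hasDerivAt_inverse hf hpos hg hfg (u + m))).log
      (hBpos _).ne').comp_add_const u m
    refine h2.congr_deriv ?_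
    rw [hfg (u + m), Function.comp_apply, hBh, imageDensity]
    have h3 := (hpos (g (u + m))).ne'
    have h4 := (gaussDensity_pos ht (g (u + m))).ne'
    have h5 := (hhpos (u + m)).ne'
    field_simp
    ring
  have hc : Continuous fun u ↦ u / h (u + m) :=
    continuous_id.div₀ (hhc.comp (continuous_add_const m)) fun u ↦ (hhpos _).ne'
  have hint := intervalIntegral.integral_eq_sub_of_hasDerivAt (a := 0) (b := y - m)
    (fun u _ ↦ hlog u) (hc.neg.intervalIntegrable _ _)
  rw [intervalIntegral.integral_neg, sub_add_cancel, zero_add] at hint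
  rw [hint, Real.exp_sub, Real.exp_log (hBpos _), Real.exp_log (hBpos _), hBh y,
    show B (g m) = A / 2 by
      rw [hA]
      exact setIntegral_Ioi_sub_mean_eq_half (strictMono_of_deriv_pos hpos) hfg hfi hm]
  have hApos : 0 < A / 2 := by
    rw [hA, ← setIntegral_Ioi_sub_mean_eq_half (strictMono_of_deriv_pos hpos) hfg hfi hm]
    exact hBpos _
  have hA0 : A ≠ 0 := by linarith
  have h5 := (hhpos y).ne'
  field_simp

end Density

/-- Monotonicity in the weight `w` of `∫_0^c u w(u) du`, whatever the sign of `c`. -/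
lemma integral_id_mul_mono {w₁ w₂ : ℝ → ℝ} (h₁ : Continuous w₁) (h₂ : Continuous w₂)
    (hle : ∀ u, w₁ u ≤ w₂ u) (c : ℝ) :
    ∫ u in (0 : ℝ)..c, u * w₁ u ≤ ∫ u in (0 : ℝ)..c, u * w₂ u := by
  rcases le_total 0 c with hc | hc
  · exact intervalIntegral.integral_mono_on hc (Continuous.intervalIntegrable (by fun_prop) _ _)
      (Continuous.intervalIntegrable (by fun_prop) _ _)
      fun u hu ↦ mul_le_mul_of_nonneg_left (hle u) hu.1
  · rw [intervalIntegral.integral_symm, intervalIntegral.integral_symm c 0, neg_le_neg_iff]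
    exact intervalIntegral.integral_mono_on hc (Continuous.intervalIntegrable (by fun_prop) _ _)
      (Continuous.intervalIntegrable (by fun_prop) _ _)
      fun u hu ↦ mul_le_mul_of_nonpos_left (hle u) hu.2

/-! ### Bounds on the Stein kernel in terms of the value -/

section KernelBounds

variable {t : ℝ≥0} {f g : ℝ → ℝ} {p r : ℝ}

lemma imageSteinKernel_le (ht : 0 < t) (hf' : Continuous (deriv f)) (hpos : ∀ x, 0 < deriv f x)
    (hp : 0 ≤ p) (hCf : BddAbove (range (growthQuotient (deriv f) p)))
    (hCg : BddAbove (range (growthQuotient g r))) (y : ℝ) :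
    imageSteinKernel t f g y
      ≤ upperKernelConst t (deriv f) g p r * t * (1 + |y| ^ (2 * p * r)) := by
  set C := growthConst (deriv f) p
  set D := growthConst g r
  have hD : 0 ≤ D := growthConst_nonneg g r
  have hδ := one_le_deltaConst (2 * p)
  have h1 := mul_mehlerAverage_le ht hf' hp (growthConst_nonneg _ _) (abs_le_growthConst hCf)
    (fun x ↦ (hpos x).le) (g y)
  have h2 : |g y| ^ (2 * p) ≤ D ^ (2 * p) * deltaConst (2 * p) * (1 + |y| ^ (2 * p * r)) :=
    abs_rpow_le_of_growth (by positivity) hD (abs_le_growthConst hCg y)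
  have hY : 0 ≤ |y| ^ (2 * p * r) := by positivity
  have h3 : 1 + |g y| ^ (2 * p)
      ≤ (1 + D ^ (2 * p)) * deltaConst (2 * p) * (1 + |y| ^ (2 * p * r)) := by
    have : 1 ≤ deltaConst (2 * p) * (1 + |y| ^ (2 * p * r)) :=
      one_le_mul_of_one_le_of_one_le hδ (by linarith)
    linarith
  have hb : 0 ≤ bigDConst t p := by
    have : 0 ≤ 1 / 2 + deltaConst p / (1 + p) := by
      have := deltaConst_pos p
      positivity
    exact this.trans (le_max_right _ _)
  calc imageSteinKernel t f g y
      ≤ t * (C ^ 2 * bigDConst t p * (1 + |g y| ^ (2 * p))) :=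
        mul_le_mul_of_nonneg_left h1 t.coe_nonneg
    _ ≤ t * (C ^ 2 * bigDConst t p
          * ((1 + D ^ (2 * p)) * deltaConst (2 * p) * (1 + |y| ^ (2 * p * r)))) := by gcongr
    _ = _ := by
        rw [upperKernelConst]
        ring

lemma le_imageSteinKernel (ht : 0 < t) (hf' : Continuous (deriv f)) (hp : 0 ≤ p)
    (hCf : BddAbove (range (growthQuotient (deriv f) p)))
    (hCg : BddAbove (range (growthQuotient g r))) {q K : ℝ} (hq : 0 ≤ q) (hK : 0 < K)
    (hlow : ∀ x, (K * (1 + |x| ^ q))⁻¹ ≤ deriv f x) (y : ℝ) :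
    lowerKernelConst t g r K q * t / (1 + |y| ^ (2 * q * r)) ≤ imageSteinKernel t f g y := by
  set D := growthConst g r
  have hD : 0 ≤ D := growthConst_nonneg g r
  have hδ := deltaConst_pos q
  have hδ' := deltaConst_pos (2 * q)
  have hμ := muConst_pos ht q
  have h2 : |g y| ^ (2 * q) ≤ D ^ (2 * q) * deltaConst (2 * q) * (1 + |y| ^ (2 * q * r)) :=
    abs_rpow_le_of_growth (by positivity) hD (abs_le_growthConst hCg y)
  have hY : 0 ≤ |y| ^ (2 * q * r) := by positivity
  have h3 : 1 + |g y| ^ (2 * q)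
      ≤ (1 + D ^ (2 * q) * deltaConst (2 * q)) * (1 + |y| ^ (2 * q * r)) := by linarith
  calc lowerKernelConst t g r K q * t / (1 + |y| ^ (2 * q * r))
      = t * (muConst t q / (2 * deltaConst q * K ^ 2
          * ((1 + D ^ (2 * q) * deltaConst (2 * q)) * (1 + |y| ^ (2 * q * r))))) := by
        have : lowerKernelConst t g r K q = muConst t q
            / (2 * deltaConst q * K ^ 2 * (1 + D ^ (2 * q) * deltaConst (2 * q))) := rfl
        rw [this]
        field_simp
    _ ≤ t * (muConst t q / (2 * deltaConst q * K ^ 2 * (1 + |g y| ^ (2 * q)))) := by gcongr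
    _ ≤ imageSteinKernel t f g y :=
        mul_le_mul_of_nonneg_left (le_mul_mehlerAverage ht hf' hp (growthConst_nonneg _ _)
          (abs_le_growthConst hCf) hq hK hlow (g y)) t.coe_nonneg

lemma lowerKernelConst_pos (ht : 0 < t) (g : ℝ → ℝ) (r : ℝ) {K : ℝ} (q : ℝ) (hK : 0 < K) :
    0 < lowerKernelConst t g r K q := by
  have hδ := deltaConst_pos q
  have hδ' := deltaConst_pos (2 * q)
  have hμ := muConst_pos ht q
  have hD := growthConst_nonneg g r
  unfold lowerKernelConst
  positivity

end KernelBounds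

/-! ### The density bounds -/

lemma IsBrownianOn.hasLaw_eval {Ω : Type*} [MeasurableSpace Ω] {P : Measure Ω} {T : ℝ≥0}
    {W : ℝ≥0 → Ω → ℝ} (hW : IsBrownianOn T W P) {t : ℝ≥0} (htT : t ≤ T) :
    HasLaw (W t) (gaussianReal 0 t) P :=
  (BrownianReal.measurePreserving_eval_projectiveFamily ⟨t, by simp⟩).hasLaw.comp
    (hW.hasLaw {t} (by simpa using htT))

theorem mainTheorem5 {Ω : Type*} [MeasurableSpace Ω] (P : Measure Ω) [IsProbabilityMeasure P]
    (T : ℝ≥0) (W : ℝ≥0 → Ω → ℝ) (hW : IsBrownianOn T W P)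
    (t : ℝ≥0) (ht : 0 < t) (htT : t ≤ T)
    (v : ℝ → ℝ → ℝ) (hv : IsC11 T v)
    (hint : Integrable (fun ω ↦ v t (W t ω)) P)
    (habove : ¬ BddAbove (range (v t))) (hbelow : ¬ BddBelow (range (v t)))
    (hpos : ∀ x : ℝ, 0 < deriv (v t) x)
    (hlow_pos : 0 < lowerGrowthRate (v t)) (hlow_fin : lowerGrowthRate (v t) < ⊤)
    (hup_fin : upperGrowthRate (deriv (v t)) < ⊤)
    (q K : ℝ) (hq : 0 < q) (hK : 0 < K)
    (hinv : ∀ x : ℝ, 1 / deriv (v t) x ≤ K * (1 + |x| ^ q))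
    -- `vinv` is the inverse function of `x ↦ v (t, x)`; `a`, `b` are the upper growth rates of
    -- the space derivative and of the inverse; `m` and `A` are the mean and the mean absolute
    -- deviation of `v (t, W_t)`
    (vinv : ℝ → ℝ) (hvinv : vinv = Function.invFun (v t))
    (a b m A : ℝ)
    (ha : a = (upperGrowthRate (deriv (v t))).toReal)
    (hb : b = (upperGrowthRate vinv).toReal)
    (hm : m = ∫ ω, v t (W t ω) ∂P)
    (hA : A = ∫ ω, |v t (W t ω) - m| ∂P) :
    -- the inverse, its growth rate and the constants are well defined and finite
    Function.Bijective (v t) ∧ upperGrowthRate vinv < ⊤ ∧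
    (∀ ε : ℝ, 0 < ε → BddAbove (range (growthQuotient (deriv (v t)) (a + ε)))) ∧
    (∀ ε' : ℝ, 0 < ε' → BddAbove (range (growthQuotient vinv (b + ε')))) ∧
    -- the law has a (continuous) density, with the upper and lower bounds
    ∃ ρ : ℝ → ℝ, Continuous ρ ∧ (∀ y, 0 ≤ ρ y) ∧
      P.map (fun ω ↦ v t (W t ω)) = volume.withDensity (fun y ↦ ENNReal.ofReal (ρ y)) ∧
      ∀ ε ε' : ℝ, 0 < ε → 0 < ε' → ∀ y : ℝ,
        ρ y ≤ A / (2 * lowerKernelConst t vinv (b + ε') K q * t)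
            * (1 + |y| ^ (2 * q * (b + ε')))
            * Real.exp (-∫ x in (0 : ℝ)..(y - m),
                (upperKernelConst t (deriv (v t)) vinv (a + ε) (b + ε') * t)⁻¹ * x
                  / (1 + |x + m| ^ (2 * (a + ε) * (b + ε')))) ∧
        (2 * upperKernelConst t (deriv (v t)) vinv (a + ε) (b + ε') * t)⁻¹ * A
            / (1 + |y| ^ (2 * (a + ε) * (b + ε')))
            * Real.exp (-∫ x in (0 : ℝ)..(y - m),
                x * (1 + |x + m| ^ (2 * q * (b + ε')))
                  / (lowerKernelConst t vinv (b + ε') K q * t)) ≤ ρ y := by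
  have htmem : (t : ℝ) ∈ Icc (0 : ℝ) T := ⟨t.coe_nonneg, by exact_mod_cast htT⟩
  have hf : Differentiable ℝ (v t) := hv.differentiable_space t htmem
  have hf' : Continuous (deriv (v t)) :=
    hv.continuousOn_space_deriv.comp_continuous (f := fun x : ℝ ↦ ((t : ℝ), x)) (by fun_prop)
      fun x ↦ ⟨htmem, mem_univ _⟩
  have hlaw := hW.hasLaw_eval htT
  have hbij := bijective_of_deriv_pos hf hpos habove hbelow
  obtain ⟨e, he, hes⟩ := exists_homeomorph_of_deriv_pos hpos hbij
  have hsymm : ⇑e.symm = vinv := by rw [hvinv]; exact funext hes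
  have hg : Continuous vinv := hsymm ▸ e.symm.continuous
  have hgt : Tendsto vinv (cocompact ℝ) (cocompact ℝ) :=
    hsymm ▸ e.symm.isClosedEmbedding.tendsto_cocompact
  have hfg : Function.RightInverse vinv (v t) := hvinv ▸ Function.rightInverse_invFun hbij.2
  have hgf : Function.LeftInverse vinv (v t) := hvinv ▸ Function.leftInverse_invFun hbij.1
  have hgfin : upperGrowthRate vinv < ⊤ := upperGrowthRate_lt_top_of_rightInverse hfg hgt hlow_pos
  have hCf : ∀ ε : ℝ, 0 < ε → BddAbove (range (growthQuotient (deriv (v t)) (a + ε))) :=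
    fun ε hε ↦ ha ▸ bddAbove_growthQuotient hf' hup_fin hε
  have hCg : ∀ ε : ℝ, 0 < ε → BddAbove (range (growthQuotient vinv (b + ε))) :=
    fun ε hε ↦ hb ▸ bddAbove_growthQuotient hg hgfin hε
  have ha0 : 0 ≤ a := ha ▸ ENNReal.toReal_nonneg
  have hfi : Integrable (v t) (gaussianReal 0 t) := by
    rw [← hlaw.map_eq, integrable_map_measure hf.continuous.aestronglyMeasurable hlaw.aemeasurable]
    exact hint
  have hfi' : Integrable (deriv (v t)) (gaussianReal 0 t) :=
    integrable_of_growth t hf' (by linarith : 0 ≤ a + 1) (growthConst_nonneg _ _)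
      (abs_le_growthConst (hCf 1 one_pos))
  have hm' : m = ∫ z, v t z ∂(gaussianReal 0 t) := by
    rw [hm, ← hlaw.map_eq, integral_map hlaw.aemeasurable hf.continuous.aestronglyMeasurable]
  have hA' : A = ∫ z, |v t z - m| ∂(gaussianReal 0 t) := by
    have habs : Continuous fun z ↦ |v t z - m| := (hf.continuous.sub continuous_const).abs
    rw [hA, ← hlaw.map_eq, integral_map hlaw.aemeasurable habs.aestronglyMeasurable]
  have hA0 : 0 ≤ A := hA ▸ integral_nonneg fun _ ↦ abs_nonneg _
  have hlow : ∀ x, (K * (1 + |x| ^ q))⁻¹ ≤ deriv (v t) x := fun x ↦ by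
    rw [inv_le_comm₀ (by positivity) (hpos x), ← one_div]
    exact hinv x
  have hR : ∀ x, 0 < mehlerAverage t (deriv (v t)) x := fun x ↦
    lt_of_lt_of_le (div_pos (muConst_pos ht q) (by have := deltaConst_pos q; positivity))
      (le_mehlerAverage ht hf' (by linarith : 0 ≤ a + 1) (growthConst_nonneg _ _)
        (abs_le_growthConst (hCf 1 one_pos)) hq.le hK hlow x)
  obtain ⟨hhc, hρ⟩ := imageDensity_eq_exp_steinKernel ht hf hf' hpos hg hfg hfi hfi' hR hm' hA'
  refine ⟨hbij, hgfin, hCf, hCg, imageDensity t (v t) vinv,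
    continuous_imageDensity hf' hpos hg, fun y ↦ (imageDensity_pos ht hpos y).le, ?_, ?_⟩
  · rw [← map_gaussianReal_eq_withDensity ht hf hpos hg hfg hgf, ← hlaw.map_eq,
      AEMeasurable.map_map_of_aemeasurable hf.continuous.aemeasurable hlaw.aemeasurable]
    rfl
  intro ε ε' hε hε' y
  have ht' : (0 : ℝ) < t := by exact_mod_cast ht
  have hp : 0 ≤ a + ε := by linarith
  have hr : 0 ≤ b + ε' := add_nonneg (hb ▸ ENNReal.toReal_nonneg) hε'.le
  set h := imageSteinKernel t (v t) vinv with hh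
  set M := lowerKernelConst t vinv (b + ε') K q with hM
  set M' := upperKernelConst t (deriv (v t)) vinv (a + ε) (b + ε') with hM'
  set Y : ℝ → ℝ := fun y ↦ 1 + |y| ^ (2 * q * (b + ε')) with hY
  set Y' : ℝ → ℝ := fun y ↦ 1 + |y| ^ (2 * (a + ε) * (b + ε')) with hY'
  have hYpos : ∀ y, 0 < Y y := fun y ↦ by positivity
  have hYpos' : ∀ y, 0 < Y' y := fun y ↦ by positivity
  have hYc : Continuous Y :=
    continuous_const.add (continuous_abs.rpow_const fun _ ↦ Or.inr (by positivity))
  have hYc' : Continuous Y' :=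
    continuous_const.add (continuous_abs.rpow_const fun _ ↦ Or.inr (by positivity))
  have hMpos : 0 < M := lowerKernelConst_pos ht _ _ _ hK
  have hhpos : ∀ y, 0 < h y := fun y ↦ mul_pos ht' (mul_pos (hpos _) (hR _))
  have hup : ∀ y, h y ≤ M' * t * Y' y := imageSteinKernel_le ht hf' hpos hp (hCf ε hε) (hCg ε' hε')
  have hlo : ∀ y, M * t / Y y ≤ h y :=
    le_imageSteinKernel ht hf' hp (hCf ε hε) (hCg ε' hε') hq.le hK hlow
  -- the upper bound on the positive kernel forces the constant to be positive
  have hMpos' : 0 < M' := by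
    have h1 := (hhpos 0).trans_le (hup 0)
    exact pos_of_mul_pos_left (pos_of_mul_pos_left h1 (hYpos' 0).le) ht'.le
  have hinv_le : ∀ y, (h y)⁻¹ ≤ Y y / (M * t) := fun y ↦ by
    rw [← inv_div]
    exact inv_anti₀ (div_pos (mul_pos hMpos ht') (hYpos y)) (hlo y)
  have hle_inv : ∀ y, (M' * t * Y' y)⁻¹ ≤ (h y)⁻¹ := fun y ↦ inv_anti₀ (hhpos y) (hup y)
  have hci : Continuous fun u ↦ (h (u + m))⁻¹ :=
    (hhc.comp (continuous_add_const m)).inv₀ fun u ↦ (hhpos _).ne'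
  have hcl : Continuous fun u ↦ (M' * t * Y' (u + m))⁻¹ :=
    (continuous_const.mul (hYc'.comp (continuous_add_const m))).inv₀ fun u ↦
      (mul_pos (mul_pos hMpos' ht') (hYpos' _)).ne'
  have hcu : Continuous fun u ↦ Y (u + m) / (M * t) :=
    (hYc.comp (continuous_add_const m)).div_const _
  have hI1 : ∫ x in (0 : ℝ)..(y - m), (M' * t)⁻¹ * x / Y' (x + m)
      ≤ ∫ u in (0 : ℝ)..(y - m), u / h (u + m) := by
    refine le_trans (le_of_eq ?_) (integral_id_mul_mono hcl hci (fun u ↦ hle_inv _) (y - m))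
    congr 1
    ext x
    rw [mul_inv (M' * t)]
    ring
  have hI2 : ∫ u in (0 : ℝ)..(y - m), u / h (u + m)
      ≤ ∫ x in (0 : ℝ)..(y - m), x * Y (x + m) / (M * t) := by
    refine (integral_id_mul_mono hci hcu (fun u ↦ hinv_le _) (y - m)).trans_eq ?_
    congr 1
    ext x
    ring
  rw [hρ y]
  constructor
  · refine mul_le_mul ?_ (Real.exp_le_exp.2 (neg_le_neg hI1)) (Real.exp_pos _).le (by positivity)
    calc A / 2 / h y = A / 2 * (h y)⁻¹ := div_eq_mul_inv _ _
      _ ≤ A / 2 * (Y y / (M * t)) := mul_le_mul_of_nonneg_left (hinv_le y) (by positivity)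
      _ = A / (2 * M * t) * Y y := by field_simp
  · refine mul_le_mul ?_ (Real.exp_le_exp.2 (neg_le_neg hI2)) (Real.exp_pos _).le
      (div_nonneg (by positivity) (hhpos y).le)
    calc (2 * M' * t)⁻¹ * A / Y' y = A / 2 * (M' * t * Y' y)⁻¹ := by
          have := (hYpos' y).ne'
          field_simp
      _ ≤ A / 2 * (h y)⁻¹ := mul_le_mul_of_nonneg_left (hle_inv y) (by positivity)
      _ = A / 2 / h y := (div_eq_mul_inv _ _).symm
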